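/- Let $K$ be a field and let $K[\mathbf{x}]=K[x_1,\ldots,x_n]$. A coordinate ideal in $K[\mathbf{x}]$ is an ideal generated by a (possibly empty) subset of $\{x_1,\ldots,x_n\}$. A monomial ideal $\mathcal{I}\subseteq K[\mathbf{x}]$ is called tame if the blowup $\operatorname{Proj}\bigl(\bigoplus_{d\ge 0}\mathcal{I}^d\bigr)$ of $\mathbb{A}^n_K=\operatorname{Spec} K[\mathbf{x}]$ with center $\mathcal{I}$ is smooth over $K$. Let $\mathcal{I}_1,\ldots,\mathcal{I}_k$ be coordinate ideals in $K[\mathbf{x}]$ such that the product $\prod_{i=1}^{k}\mathcal{I}_i$ is not tame. Then the ideal \[ \prod_{i=1}^{k}\mathcal{I}_i\cdot\prod_{1\le i<j\le k}(\mathcal{I}_i+\mathcal{I}_j) \] has the same zero set in $\mathbb{A}^n_K$ as $\prod_{i=1}^{k}\mathcal{I}_i$, and it is tame. -/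

import Mathlib

open AlgebraicGeometry CategoryTheory

noncomputable section

namespace TameIdeal

universe u

section Blowup

variable {R : Type u} [CommRing R] (I : Ideal R)

/-- The degree `d` part `Iᵈ tᵈ` of the Rees algebra `R[It] = ⨁ Iᵈ tᵈ ⊆ R[t]`. -/
def reesGrading (d : ℕ) : Submodule R (reesAlgebra I) :=
  (LinearMap.range (Polynomial.monomial (R := R) d)).comap (reesAlgebra I).val.toLinearMap

theorem mem_reesGrading {d : ℕ} {f : reesAlgebra I} :
    f ∈ reesGrading I d ↔ ∃ r : R, Polynomial.monomial d r = (f : Polynomial R) :=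
  Iff.rfl

/-- The homogeneous component of degree `d` of an element of the Rees algebra. -/
def reesComponent (f : reesAlgebra I) (d : ℕ) : reesGrading I d :=
  ⟨⟨Polynomial.monomial d ((f : Polynomial R).coeff d),
    reesAlgebra.monomial_mem.mpr (f.2 d)⟩, ⟨_, rfl⟩⟩

instance reesGrading_gradedMonoid : SetLike.GradedMonoid (reesGrading I) where
  one_mem := ⟨1, rfl⟩
  mul_mem := by
    rintro i j f g ⟨r, hr⟩ ⟨s, hs⟩
    refine ⟨r * s, ?_⟩
    rw [← Polynomial.monomial_mul_monomial, hr, hs]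
    rfl

instance reesGrading_decomposition : DirectSum.Decomposition (reesGrading I) := by
  classical
  exact
  { decompose' := fun f =>
      ∑ d ∈ (f : Polynomial R).support, DirectSum.of (fun d => reesGrading I d) d
        (reesComponent I f d)
    left_inv := by
      intro f
      apply Subtype.ext
      rw [map_sum]
      simp only [DirectSum.coeAddMonoidHom_of]
      rw [AddSubmonoidClass.coe_finsetSum]
      exact ((f : Polynomial R).as_sum_support).symm
    right_inv := by
      intro x
      have key : ∀ (f : reesAlgebra I) (e : ℕ),
          (∑ d ∈ (f : Polynomial R).support, DirectSum.of (fun d => reesGrading I d) d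
            (reesComponent I f d)) e = reesComponent I f e := by
        intro f e
        rw [DFinsupp.finsetSum_apply]
        by_cases he : e ∈ (f : Polynomial R).support
        · rw [Finset.sum_eq_single_of_mem e he]
          · exact DirectSum.of_eq_same _ _
          · intro d _ hd
            exact DirectSum.of_eq_of_ne _ _ _ hd.symm
        · rw [Finset.sum_eq_zero]
          · apply Subtype.ext
            apply Subtype.ext
            simp [reesComponent, Polynomial.notMem_support_iff.mp he]
          · intro d hd
            refine DirectSum.of_eq_of_ne _ _ _ ?_
            rintro rfl
            exact he hd
      refine DFinsupp.ext fun e => (key _ e).trans ?_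
      apply Subtype.ext
      apply Subtype.ext
      change Polynomial.monomial e
        (((DirectSum.coeAddMonoidHom (reesGrading I) x : reesAlgebra I) :
          Polynomial R).coeff e) = _
      induction x using DirectSum.induction_on with
      | zero => simp
      | of d y =>
        obtain ⟨y, r, hr⟩ := y
        rw [DirectSum.coeAddMonoidHom_of]
        by_cases h : d = e
        · subst h
          rw [DirectSum.of_eq_same]
          change Polynomial.monomial d (Polynomial.coeff (y : Polynomial R) d) = y
          have hr' : Polynomial.monomial d r = (y : Polynomial R) := hr
          rw [← hr']
          simp
        · rw [DirectSum.of_eq_of_ne _ _ _ (Ne.symm h)]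
          change Polynomial.monomial e (Polynomial.coeff (y : Polynomial R) e) = 0
          have hr' : Polynomial.monomial d r = (y : Polynomial R) := hr
          rw [← hr', Polynomial.coeff_monomial, if_neg h, map_zero]
      | add x y hx hy =>
        rw [map_add, DirectSum.add_apply]
        simp only [Subalgebra.coe_add, Polynomial.coeff_add, map_add, Submodule.coe_add, hx, hy] }

instance reesGrading_gradedAlgebra : GradedAlgebra (reesGrading I) where

/-- The blowup of the affine scheme `Spec R` with center the ideal `I`: the scheme
`Proj (⨁ Iᵈ)`. -/
abbrev blowup : Scheme.{u} :=
  Proj (reesGrading I)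

/-- The blowup map `Proj (⨁ Iᵈ) ⟶ Spec R`. -/
def blowupMap : blowup I ⟶ Spec (CommRingCat.of R) :=
  Proj.toSpecZero (reesGrading I) ≫
    Spec.map (CommRingCat.ofHom (algebraMap R (reesGrading I 0)))

end Blowup

variable {K : Type u} [Field K] {n : ℕ}

/-- An ideal of `K[x₁, …, xₙ]` is tame if the blowup of affine `n`-space with center this ideal
is smooth over `K`. -/
def IsTame (I : Ideal (MvPolynomial (Fin n) K)) : Prop :=
  Smooth (blowupMap I ≫
    Spec.map (CommRingCat.ofHom (algebraMap K (MvPolynomial (Fin n) K))))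

/-- A coordinate ideal of `K[x₁, …, xₙ]` is an ideal generated by a subset of the variables. -/
def IsCoordinateIdeal (I : Ideal (MvPolynomial (Fin n) K)) : Prop :=
  ∃ S : Set (Fin n), I = Ideal.span (MvPolynomial.X '' S)

/-- The zero set `V(I)` in affine `n`-space, the spectrum of `K[x₁, …, xₙ]`. -/
def zeroSet (I : Ideal (MvPolynomial (Fin n) K)) :
    Set (PrimeSpectrum (MvPolynomial (Fin n) K)) :=
  PrimeSpectrum.zeroLocus (I : Set (MvPolynomial (Fin n) K))

/-- The product `∏_{i < j} (Iᵢ + Iⱼ)`. -/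
def pairwiseSumProduct {k : ℕ} (I : Fin k → Ideal (MvPolynomial (Fin n) K)) :
    Ideal (MvPolynomial (Fin n) K) :=
  ∏ p : Fin k × Fin k with p.1 < p.2, (I p.1 + I p.2)

end TameIdeal

end

/-! Adjoining the pairwise unions makes the family of variable sets `S t` behave well under any
linear order on the variables. Let `c t` be the minimal element of `S t`. If `c i < c j` for two of
the original sets, their union contains `c j` and has minimum `c i` (`exists_isMinimalChoice`).

Put `f = ∏ X (c t)`. The chart `D₊(f t)` is then an affine space. Each variable `X b` is replaced by
its quotient by the largest chosen variable strictly below `b` among the sets containing `b`, or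
kept if there is none. All required divisibilities follow because these chosen variables form chains
(`IsMinimalChoice.exists_chart`, `smooth_chartMap_comp_C`).

Such charts cover the blowup: a valuation ring centred at a given point orders the variables by
divisibility, and the resulting chart contains the point (`exists_minimalChoice_notMem`). -/

namespace TameIdeal

universe u

/-! ### Monomial coordinate changes from minimal choices. -/

section Combinatorics

variable {K : Type*} [Field K] {ι T : Type*}

/-- If every variable indexed by `S t` is divisible by the one indexed by `c t` after applying `θ`,
then the extension along `θ` of the product of the coordinate ideals of the `S t` is contained in
the principal ideal generated by the product of the chosen variables. -/
theorem map_prod_span_X_le [Fintype T] {B : Type*} [CommRing B] (θ : MvPolynomial ι K →+* B)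
    (S : T → Set ι) (c : T → ι)
    (h : ∀ t, ∀ b ∈ S t, θ (MvPolynomial.X (c t)) ∣ θ (MvPolynomial.X b)) :
    Ideal.map θ (∏ t, Ideal.span (MvPolynomial.X '' S t)) ≤
      Ideal.span {θ (∏ t, MvPolynomial.X (c t))} := by
  have e : Ideal.map θ (∏ t, Ideal.span (MvPolynomial.X '' S t)) =
      ∏ t, Ideal.map θ (Ideal.span (MvPolynomial.X '' S t)) :=
    map_prod (Ideal.mapHom θ) _ _
  rw [e, map_prod, ← Ideal.prod_span_singleton]
  refine Finset.prod_le_prod (fun _ _ => bot_le) fun t _ => ?_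
  rw [Ideal.map_span, Ideal.span_le]
  rintro _ ⟨_, ⟨b, hb, rfl⟩, rfl⟩
  exact Ideal.mem_span_singleton.mpr (h t b hb)

variable {W : Type*} [LinearOrder W]

/-- A system of subsets `S t` with `w`-minimal elements `c t`, such that a chosen element with
smaller weight than another one is the chosen element of a set containing the latter. -/
structure IsMinimalChoice (S : T → Set ι) (w : ι → W) (c : T → ι) : Prop where
  injective : Function.Injective w
  mem : ∀ t, c t ∈ S t
  le : ∀ t, ∀ b ∈ S t, w (c t) ≤ w b
  exists_mem : ∀ t t₀, w (c t) < w (c t₀) → ∃ t', c t₀ ∈ S t' ∧ c t' = c t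

variable {S : T → Set ι} {w : ι → W} {c : T → ι}

/-- The set containing `b` whose chosen element is the largest one below `b`, if there is any. -/
theorem exists_parent [Finite T] (S : T → Set ι) (w : ι → W) (c : T → ι) (b : ι) :
    ∃ p : Option T, (p = none → ∀ t, b ∈ S t → w (c t) < w b → False) ∧
      ∀ t₀, p = some t₀ → b ∈ S t₀ ∧ w (c t₀) < w b ∧
        ∀ t, b ∈ S t → w (c t) < w b → w (c t) ≤ w (c t₀) := by
  by_cases h : ∃ t, b ∈ S t ∧ w (c t) < w b
  · obtain ⟨t₀, ht₀, hmax⟩ := Set.exists_max_image {t | b ∈ S t ∧ w (c t) < w b}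
      (fun t => w (c t)) (Set.toFinite _) h
    refine ⟨some t₀, by simp, ?_⟩
    rintro _ ⟨⟩
    exact ⟨ht₀.1, ht₀.2, fun t h₁ h₂ => hmax t ⟨h₁, h₂⟩⟩
  · push Not at h
    exact ⟨none, fun _ t h₁ h₂ => (h t h₁).not_gt h₂, by simp⟩

/-- The monomials expressing the variables of the polynomial ring through those of a chart. -/
theorem exists_chart_monomials [Finite ι] (w : ι → W) (c : T → ι) (par : ι → Option T)
    (hpar : ∀ b t, par b = some t → w (c t) < w b) :
    ∃ m : ι → MvPolynomial ι K, ∀ b, (par b = none → m b = MvPolynomial.X b) ∧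
      ∀ t, par b = some t → m b = MvPolynomial.X b * m (c t) := by
  classical
  have wf : WellFounded (InvImage (· < ·) w) :=
    @Finite.wellFounded_of_trans_of_irrefl ι _ (InvImage (· < ·) w)
      ⟨fun _ _ _ h₁ h₂ => lt_trans (α := W) h₁ h₂⟩ ⟨fun _ h => lt_irrefl (α := W) _ h⟩
  -- The value `0` is never used: `hpar` makes every parent's chosen variable smaller.
  let F : ∀ b, (∀ a, InvImage (· < ·) w a b → MvPolynomial ι K) → MvPolynomial ι K :=
    fun b ih => (par b).elim (MvPolynomial.X b) fun t =>
      if h : w (c t) < w b then MvPolynomial.X b * ih (c t) h else 0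
  refine ⟨wf.fix F, fun b => ⟨fun h => ?_, fun t h => ?_⟩⟩
  · rw [wf.fix_eq]
    simp [F, h]
  · rw [wf.fix_eq]
    simp [F, h, hpar b t h]

theorem IsMinimalChoice.chart_monomial_dvd [Finite ι] (hc : IsMinimalChoice S w c)
    {par : ι → Option T}
    (hnone : ∀ b, par b = none → ∀ t, b ∈ S t → w (c t) < w b → False)
    (hsome : ∀ b t₀, par b = some t₀ → b ∈ S t₀ ∧ w (c t₀) < w b ∧
      ∀ t, b ∈ S t → w (c t) < w b → w (c t) ≤ w (c t₀))
    {m : ι → MvPolynomial ι K}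
    (hm : ∀ b t, par b = some t → m b = MvPolynomial.X b * m (c t)) (b : ι) :
    ∀ t, b ∈ S t → m (c t) ∣ m b := by
  have wf : WellFounded (InvImage (· < ·) w) :=
    @Finite.wellFounded_of_trans_of_irrefl ι _ (InvImage (· < ·) w)
      ⟨fun _ _ _ h₁ h₂ => lt_trans (α := W) h₁ h₂⟩ ⟨fun _ h => lt_irrefl (α := W) _ h⟩
  induction b using wf.induction with
  | _ b ih =>
    intro t ht
    rcases (hc.le t b ht).eq_or_lt with h | h
    · rw [hc.injective h]
    · cases hp : par b with
      | none => exact (hnone b hp t ht h).elim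
      | some t₀ =>
        obtain ⟨_, hlt, hmax⟩ := hsome b t₀ hp
        rw [hm b t₀ hp]
        refine Dvd.dvd.mul_left ?_ _
        rcases (hmax t ht h).eq_or_lt with h' | h'
        · rw [hc.injective h']
        -- Here `c t` lies strictly below the parent `c t₀`. Some set containing `c t₀` also chooses
        -- `c t`, so induction applies at `c t₀`.
        · obtain ⟨t', ht', e⟩ := hc.exists_mem t t₀ h'
          rw [← e]
          exact ih _ hlt t' ht'

/-- The change of coordinates of the chart of the blowup attached to a minimal choice. -/
theorem IsMinimalChoice.exists_chart [Finite ι] [Fintype T] (hc : IsMinimalChoice S w c) :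
    ∃ (θ : MvPolynomial ι K →ₐ[K] MvPolynomial ι K) (g : ι → MvPolynomial ι K),
      (∀ a, g a ∈ ∏ t, Ideal.span (MvPolynomial.X '' S t)) ∧
      Ideal.map θ.toRingHom (∏ t, Ideal.span (MvPolynomial.X '' S t)) ≤
        Ideal.span {θ (∏ t, MvPolynomial.X (c t))} ∧
      θ (∏ t, MvPolynomial.X (c t)) ≠ 0 ∧
      (∀ a, θ (g a) = MvPolynomial.X a * θ (∏ t, MvPolynomial.X (c t))) ∧
      ∀ (B : Type u) [CommRing B] (β φ : MvPolynomial ι K →+* B),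
        IsLeftRegular (β (∏ t, MvPolynomial.X (c t))) →
        (∀ k, φ (MvPolynomial.C k) = β (MvPolynomial.C k)) →
        (∀ a, φ (MvPolynomial.X a) * β (∏ t, MvPolynomial.X (c t)) = β (g a)) →
        φ.comp θ.toRingHom = β := by
  classical
  have wf : WellFounded (InvImage (· < ·) w) :=
    @Finite.wellFounded_of_trans_of_irrefl ι _ (InvImage (· < ·) w)
      ⟨fun _ _ _ h₁ h₂ => lt_trans (α := W) h₁ h₂⟩ ⟨fun _ h => lt_irrefl (α := W) _ h⟩
  choose par hnone hsome using exists_parent S w c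
  obtain ⟨m, hm⟩ := exists_chart_monomials (K := K) w c par fun b t h => (hsome b t h).2.1
  have hdvd := hc.chart_monomial_dvd hnone hsome fun b => (hm b).2
  have hm0 : ∀ b, m b ≠ 0 := by
    intro b
    induction b using wf.induction with
    | _ b ih =>
      cases hp : par b with
      | none => rw [(hm b).1 hp]; exact MvPolynomial.X_ne_zero b
      | some t =>
        rw [(hm b).2 t hp]
        exact mul_ne_zero (MvPolynomial.X_ne_zero b) (ih _ (hsome b t hp).2.1)
  set f : MvPolynomial ι K := ∏ t, MvPolynomial.X (c t) with hf
  -- Swapping one factor `X (c t₀)` of `f` for `X b` keeps the product in the ideal and realises `X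
  -- b / X (c t₀)` as `g b / f`.
  let g : ι → MvPolynomial ι K := fun b => (par b).elim (f * MvPolynomial.X b) fun t₀ =>
    ∏ t, MvPolynomial.X (Function.update c t₀ b t)
  have hgn : ∀ b, par b = none → g b = f * MvPolynomial.X b := fun b h => by simp [g, h]
  have hgs : ∀ b t₀, par b = some t₀ →
      g b * MvPolynomial.X (c t₀) = f * MvPolynomial.X b := by
    intro b t₀ h
    simp only [g, h, Option.elim]
    rw [hf, ← Finset.mul_prod_erase _ _ (Finset.mem_univ t₀),
      ← Finset.mul_prod_erase _ _ (Finset.mem_univ t₀), Function.update_self,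
      Finset.prod_congr rfl fun t ht => by rw [Function.update_of_ne (Finset.ne_of_mem_erase ht)]]
    ring
  have hmem : ∀ d : T → ι, (∀ t, d t ∈ S t) →
      ∏ t, (MvPolynomial.X (d t) : MvPolynomial ι K) ∈
        ∏ t, Ideal.span (MvPolynomial.X '' S t) := fun d hd =>
    Ideal.prod_mem_prod fun t _ => Ideal.subset_span ⟨_, hd t, rfl⟩
  let θ : MvPolynomial ι K →ₐ[K] MvPolynomial ι K := MvPolynomial.aeval m
  have hθX : ∀ b, θ (MvPolynomial.X b) = m b := fun b => MvPolynomial.aeval_X m b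
  have hθf : θ f ≠ 0 := by
    rw [hf, map_prod]
    exact Finset.prod_ne_zero_iff.mpr fun t _ => by rw [hθX]; exact hm0 _
  refine ⟨θ, g, ?_, ?_, hθf, ?_, ?_⟩
  · intro b
    cases hp : par b with
    | none => rw [hgn b hp]; exact Ideal.mul_mem_right _ _ (hmem c hc.mem)
    | some t₀ =>
      simp only [g, hp, Option.elim]
      refine hmem _ fun t => ?_
      rcases eq_or_ne t t₀ with rfl | h
      · rw [Function.update_self]; exact (hsome b t hp).1
      · rw [Function.update_of_ne h]; exact hc.mem t
  · refine map_prod_span_X_le θ.toRingHom S c fun t b hb => ?_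
    change θ _ ∣ θ _
    rw [hθX, hθX]
    exact hdvd b t hb
  · intro b
    cases hp : par b with
    | none => rw [hgn b hp, map_mul, hθX, (hm b).1 hp, mul_comm]
    | some t₀ =>
      have := congrArg θ (hgs b t₀ hp)
      rw [map_mul, map_mul, hθX, hθX, (hm b).2 t₀ hp] at this
      refine mul_right_cancel₀ (hm0 (c t₀)) ?_
      rw [this]
      ring
  · intro B _ β φ hreg hC hX
    refine MvPolynomial.ringHom_ext (fun k => ?_) fun b => ?_
    · change φ (θ (MvPolynomial.C k)) = _
      rw [MvPolynomial.algHom_C, MvPolynomial.algebraMap_eq, hC]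
    · change φ (θ (MvPolynomial.X b)) = _
      rw [hθX]
      induction b using wf.induction with
      | _ b ih =>
        apply hreg
        change β f * _ = β f * _
        cases hp : par b with
        | none => rw [(hm b).1 hp, mul_comm, hX, hgn b hp, map_mul]
        | some t₀ =>
          rw [(hm b).2 t₀ hp, map_mul, ih _ (hsome b t₀ hp).2.1, ← mul_assoc, mul_comm (β f), hX,
            ← map_mul, hgs b t₀ hp, map_mul]

end Combinatorics

end TameIdeal

noncomputable section

namespace TameIdeal

universe u

/-! ### Charts of the blowup as degree-zero fractions. -/

section Rees

variable {R : Type u} [CommRing R] {I : Ideal R}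

/-- The element `r tᵈ` of the Rees algebra. -/
def reesMonomial (d : ℕ) (r : R) (hr : r ∈ I ^ d) : reesAlgebra I :=
  ⟨Polynomial.monomial d r, reesAlgebra.monomial_mem.mpr hr⟩

theorem reesMonomial_mem (d : ℕ) (r : R) (hr : r ∈ I ^ d) :
    reesMonomial d r hr ∈ reesGrading I d :=
  ⟨r, rfl⟩

theorem exists_eq_reesMonomial {d : ℕ} {z : reesAlgebra I} (hz : z ∈ reesGrading I d) :
    ∃ r, ∃ hr : r ∈ I ^ d, z = reesMonomial d r hr := by
  obtain ⟨r, hr⟩ := hz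
  have hr' : Polynomial.monomial d r = (z : Polynomial R) := hr
  exact ⟨r, reesAlgebra.monomial_mem.mp (hr' ▸ z.2), Subtype.ext hr'.symm⟩

/-- The element `f t` of degree one of the Rees algebra. -/
def reesGenerator (f : R) (hf : f ∈ I) : reesAlgebra I :=
  reesMonomial 1 f ((pow_one I).symm ▸ hf)

variable (f : R) (hf : f ∈ I)

theorem reesGenerator_mem : reesGenerator f hf ∈ reesGrading I 1 :=
  reesMonomial_mem _ _ _

theorem reesMonomial_mul_pow (d : ℕ) (r : R) (hr : r ∈ I ^ d) :
    reesMonomial d r hr * algebraMap R (reesAlgebra I) f ^ d =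
      algebraMap R (reesAlgebra I) r * reesGenerator f hf ^ d := by
  apply Subtype.ext
  change Polynomial.monomial d r * Polynomial.C f ^ d =
    Polynomial.C r * (Polynomial.monomial 1 f) ^ d
  rw [Polynomial.monomial_pow, one_mul, ← Polynomial.C_pow, Polynomial.monomial_mul_C,
    Polynomial.C_mul_monomial]

/-- The coordinate ring of the chart `D₊(f t)` of the blowup of `I`. -/
abbrev BlowupChart : Type u :=
  HomogeneousLocalization.Away (reesGrading I) (reesGenerator f hf)

/-- The structure map of the coordinate ring of a chart of a blowup. -/
def chartMap : R →+* BlowupChart f hf :=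
  (HomogeneousLocalization.fromZeroRingHom (reesGrading I) _).comp
    (algebraMap R (reesGrading I 0))

theorem val_chartMap (r : R) : (chartMap f hf r).val =
    algebraMap (reesAlgebra I) (Localization.Away (reesGenerator f hf))
      (algebraMap R (reesAlgebra I) r) := by
  rw [← Localization.mk_one_eq_algebraMap]
  rfl

/-- The fraction `(r tᵈ) / (f t)ᵈ`. -/
def chartFraction (d : ℕ) (r : R) (hr : r ∈ I ^ d) : BlowupChart f hf :=
  HomogeneousLocalization.Away.mk _ (reesGenerator_mem f hf) d (reesMonomial d r hr)
    (by rw [smul_eq_mul, mul_one]; exact reesMonomial_mem d r hr)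

theorem chartFraction_mul_pow (d : ℕ) (r : R) (hr : r ∈ I ^ d) :
    chartFraction f hf d r hr * chartMap f hf (f ^ d) = chartMap f hf r := by
  apply HomogeneousLocalization.val_injective
  rw [HomogeneousLocalization.val_mul, val_chartMap,
    val_chartMap, chartFraction, HomogeneousLocalization.Away.val_mk, Localization.mk_eq_mk',
    map_pow, mul_comm, IsLocalization.mul_mk'_eq_mk'_of_mul, mul_comm, reesMonomial_mul_pow,
    IsLocalization.mk'_eq_iff_eq_mul, map_mul]

theorem exists_eq_chartFraction (z : BlowupChart f hf) :
    ∃ d r, ∃ hr : r ∈ I ^ d, z = chartFraction f hf d r hr := by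
  obtain ⟨d, a, ha, rfl⟩ :=
    HomogeneousLocalization.Away.mk_surjective _ (reesGenerator_mem f hf) z
  have ha' := ha
  rw [smul_eq_mul, mul_one] at ha'
  obtain ⟨r, hr, rfl⟩ := exists_eq_reesMonomial ha'
  exact ⟨d, r, hr, rfl⟩

/-- The chart embeds in a localization of the Rees algebra, a domain, at the nonzero element `f t`.
-/
theorem isRegular_chartMap [IsDomain R] (hf0 : f ≠ 0) : IsLeftRegular (chartMap f hf f) := by
  have hg : reesGenerator f hf ≠ 0 := fun h => hf0 <| by
    have : Polynomial.monomial 1 f = (0 : Polynomial R) := congrArg Subtype.val h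
    simpa using this
  have hle : Submonoid.powers (reesGenerator f hf) ≤ nonZeroDivisors (reesAlgebra I) :=
    powers_le_nonZeroDivisors_of_noZeroDivisors hg
  have := IsLocalization.isDomain_localization hle
  intro x y hxy
  apply HomogeneousLocalization.val_injective
  have h := congrArg HomogeneousLocalization.val hxy
  simp only [HomogeneousLocalization.val_mul] at h
  refine mul_left_cancel₀ ?_ h
  rw [val_chartMap]
  intro h0
  have h1 := IsLocalization.injective (Localization.Away (reesGenerator f hf)) hle
    (h0.trans (map_zero _).symm)
  apply hf0
  have : Polynomial.C f = (0 : Polynomial R) := congrArg Subtype.val h1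
  simpa using this

/-- A ring homomorphism to a field that does not kill `f` extends to the chart `D₊(f t)`. -/
theorem exists_extension_chartMap {F : Type*} [Field F] (θ : R →+* F) (h : θ f ≠ 0) :
    ∃ Ψ : BlowupChart f hf →+* F, Ψ.comp (chartMap f hf) = θ := by
  -- Evaluating `t` at `1 / θ f` sends `f t` to `1`.
  let Ψ₀ : reesAlgebra I →+* F :=
    (Polynomial.eval₂RingHom θ (θ f)⁻¹).comp (reesAlgebra I).val.toRingHom
  have h1 : Ψ₀ (reesGenerator f hf) = 1 := by
    change Polynomial.eval₂ θ (θ f)⁻¹ (Polynomial.monomial 1 f) = 1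
    rw [Polynomial.eval₂_monomial, pow_one, mul_inv_cancel₀ h]
  refine ⟨(Localization.awayLift Ψ₀ _ (h1 ▸ isUnit_one)).comp
    (algebraMap (BlowupChart f hf) (Localization.Away (reesGenerator f hf))), ?_⟩
  ext r
  change Localization.awayLift Ψ₀ _ (h1 ▸ isUnit_one) (chartMap f hf r).val = _
  rw [val_chartMap]
  refine (IsLocalization.lift_eq _ _).trans ?_
  change Polynomial.eval₂ θ (θ f)⁻¹ (Polynomial.C r) = θ r
  rw [Polynomial.eval₂_C]

end Rees

/-! ### Identifying a chart with affine space. -/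

section Chart

variable {K : Type u} [Field K] {ι : Type} {I : Ideal (MvPolynomial ι K)}

theorem smooth_C [Finite ι] : (MvPolynomial.C : K →+* MvPolynomial ι K).Smooth := by
  rw [← MvPolynomial.algebraMap_eq, RingHom.smooth_algebraMap]
  exact ⟨inferInstance, inferInstance⟩

/-- A chart of a blowup of affine space with a change of coordinates is smooth over the field. -/
theorem smooth_chartMap_comp_C [Finite ι] {f : MvPolynomial ι K} (hf : f ∈ I)
    (θ : MvPolynomial ι K →ₐ[K] MvPolynomial ι K) (g : ι → MvPolynomial ι K)
    (hg : ∀ a, g a ∈ I) (hI : Ideal.map θ.toRingHom I ≤ Ideal.span {θ f}) (hθf : θ f ≠ 0)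
    (hθg : ∀ a, θ (g a) = MvPolynomial.X a * θ f)
    (hφ : ∀ (B : Type u) [CommRing B] (β φ : MvPolynomial ι K →+* B),
        IsLeftRegular (β f) → (∀ k, φ (MvPolynomial.C k) = β (MvPolynomial.C k)) →
        (∀ a, φ (MvPolynomial.X a) * β f = β (g a)) → φ.comp θ.toRingHom = β) :
    ((chartMap f hf).comp MvPolynomial.C).Smooth := by
  have hf0 : f ≠ 0 := by rintro rfl; simp at hθf
  have hreg := isRegular_chartMap f hf hf0
  have hg' : ∀ a, g a ∈ I ^ 1 := fun a => (pow_one I).symm ▸ hg a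
  let φ : MvPolynomial ι K →+* BlowupChart f hf :=
    MvPolynomial.eval₂Hom ((chartMap f hf).comp MvPolynomial.C)
      fun a => chartFraction f hf 1 (g a) (hg' a)
  have hC : ∀ k, φ (MvPolynomial.C k) = chartMap f hf (MvPolynomial.C k) := fun k =>
    MvPolynomial.eval₂Hom_C _ _ k
  have hX : ∀ a, φ (MvPolynomial.X a) * chartMap f hf f = chartMap f hf (g a) := fun a => by
    rw [← chartFraction_mul_pow f hf 1 (g a) (hg' a), pow_one f]
    exact congrArg (· * _) (MvPolynomial.eval₂Hom_X' _ _ a)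
  have hcomp := hφ _ (chartMap f hf) φ hreg hC hX
  have hcomp' : ∀ r, φ (θ r) = chartMap f hf r := fun r => RingHom.congr_fun hcomp r
  have hsurj : Function.Surjective φ := by
    intro z
    obtain ⟨d, r, hr, rfl⟩ := exists_eq_chartFraction f hf z
    -- Since `θ r = θ f ^ d * q`, the fraction `r / f ^ d` is the image of `q`.
    have h1 : θ r ∈ Ideal.span {θ f ^ d} := by
      rw [← Ideal.span_singleton_pow]
      refine Ideal.pow_right_mono hI d ?_
      rw [← Ideal.map_pow]
      exact Ideal.mem_map_of_mem θ.toRingHom hr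
    obtain ⟨q, hq⟩ := Ideal.mem_span_singleton.mp h1
    have hreg' : IsLeftRegular (chartMap f hf (f ^ d)) := by
      rw [map_pow]
      exact hreg.pow d
    refine ⟨q, hreg' ?_⟩
    change chartMap f hf (f ^ d) * φ q = chartMap f hf (f ^ d) * chartFraction f hf d r hr
    rw [mul_comm _ (chartFraction f hf d r hr), chartFraction_mul_pow, ← hcomp',
      ← hcomp' r, hq, map_mul, map_pow]
  have hinj : Function.Injective φ := by
    -- Extending `θ` to the chart gives a left inverse of `φ` up to the embedding in the fraction
    -- field.
    let F := FractionRing (MvPolynomial ι K)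
    obtain ⟨Ψ, hΨ⟩ := exists_extension_chartMap f hf
      ((algebraMap (MvPolynomial ι K) F).comp θ.toRingHom)
      (fun h => hθf (IsFractionRing.injective (MvPolynomial ι K) F (h.trans (map_zero _).symm)))
    have hΨ' : ∀ r, Ψ (chartMap f hf r) = algebraMap _ F (θ r) := fun r =>
      RingHom.congr_fun hΨ r
    have : Ψ.comp φ = algebraMap (MvPolynomial ι K) F := by
      refine MvPolynomial.ringHom_ext (fun k => ?_) fun a => ?_
      · rw [RingHom.comp_apply, hC, hΨ', MvPolynomial.algHom_C, MvPolynomial.algebraMap_eq]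
      · have h := congrArg Ψ (hX a)
        rw [map_mul, hΨ', hΨ', hθg, map_mul] at h
        refine mul_right_cancel₀ (fun h0 => hθf ?_) h
        exact IsFractionRing.injective (MvPolynomial ι K) F (h0.trans (map_zero _).symm)
    refine Function.Injective.of_comp (f := Ψ) ?_
    rw [← RingHom.coe_comp, this]
    exact IsFractionRing.injective (MvPolynomial ι K) F
  have : (chartMap f hf).comp MvPolynomial.C = φ.comp MvPolynomial.C :=
    RingHom.ext fun k => (hC k).symm
  rw [this]
  exact smooth_C.comp (.of_bijective ⟨hinj, hsurj⟩)

end Chart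

end TameIdeal

end

noncomputable section

namespace TameIdeal

universe u

/-! ### Pairwise unions and valuation rings. -/

section Choice

variable {ι W : Type*} [LinearOrder W] {k : ℕ}

/-- The family consisting of the given sets and of their pairwise unions. -/
def withUnions (P : Fin k → Set ι) : Fin k ⊕ {p : Fin k × Fin k // p.1 < p.2} → Set ι :=
  Sum.elim P fun p => P p.1.1 ∪ P p.1.2

theorem exists_isMinimalChoice [Finite ι] (P : Fin k → Set ι) (hP : ∀ i, (P i).Nonempty)
    (w : ι → W) (hw : Function.Injective w) :
    ∃ c, IsMinimalChoice (withUnions P) w c := by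
  have hne : ∀ t, (withUnions P t).Nonempty := by
    rintro (i | p)
    · exact hP i
    · exact (hP p.1.1).inl
  choose c hmem hle using fun t =>
    Set.exists_min_image (withUnions P t) w (Set.toFinite _) (hne t)
  have hinl : ∀ p a, a ∈ P p → w (c (.inl p)) ≤ w a := fun p a h => hle (.inl p) a h
  -- The minimum of a union is already the minimum of one of its two sets.
  have hred : ∀ t, ∃ i, c t = c (.inl i) := by
    rintro (i | p)
    · exact ⟨i, rfl⟩
    · rcases hmem (.inr p) with h | h
      · exact ⟨_, hw (le_antisymm (hle (.inr p) _ (.inl (hmem (.inl p.1.1)))) (hinl _ _ h))⟩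
      · exact ⟨_, hw (le_antisymm (hle (.inr p) _ (.inr (hmem (.inl p.1.2)))) (hinl _ _ h))⟩
  refine ⟨c, hw, hmem, hle, fun t t₀ hlt => ?_⟩
  obtain ⟨i, hi⟩ := hred t
  obtain ⟨j, hj⟩ := hred t₀
  rw [hi, hj] at hlt ⊢
  rcases lt_trichotomy i j with h | rfl | h
  · refine ⟨.inr ⟨(i, j), h⟩, .inr (hmem (.inl j)), ?_⟩
    have h1 := hle (.inr ⟨(i, j), h⟩) _ (.inl (hmem (.inl i)))
    rcases hmem (.inr ⟨(i, j), h⟩) with h2 | h2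
    · exact hw (le_antisymm h1 (hinl _ _ h2))
    · exact absurd (h1.trans_lt hlt) (hinl _ _ h2).not_gt
  · exact (lt_irrefl _ hlt).elim
  · refine ⟨.inr ⟨(j, i), h⟩, .inl (hmem (.inl j)), ?_⟩
    have h1 := hle (.inr ⟨(j, i), h⟩) _ (.inr (hmem (.inl i)))
    rcases hmem (.inr ⟨(j, i), h⟩) with h2 | h2
    · exact absurd (h1.trans_lt hlt) (hinl _ _ h2).not_gt
    · exact hw (le_antisymm h1 (hinl _ _ h2))

end Choice

/-- Every prime ideal of a domain is the center of a valuation ring. -/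
theorem exists_valuationSubring_isUnit_iff {D : Type*} [CommRing D] [IsDomain D] (p : Ideal D)
    [p.IsPrime] :
    ∃ (A : ValuationSubring (FractionRing D)) (i : D →+* A), Function.Injective i ∧
      ∀ y, IsUnit (i y) ↔ y ∉ p := by
  have hu : ∀ y : p.primeCompl, IsUnit (algebraMap D (FractionRing D) y) := fun y =>
    IsUnit.mk0 _ fun h => y.2 <| by
      rw [IsFractionRing.injective D (FractionRing D) (h.trans (map_zero _).symm)]
      exact p.zero_mem
  let l : Localization.AtPrime p →+* FractionRing D := IsLocalization.lift hu
  obtain ⟨A, hA, hloc⟩ := IsLocalRing.exists_factor_valuationRing l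
  let i : D →+* A := (l.codRestrict A.toSubring hA).comp (algebraMap D (Localization.AtPrime p))
  refine ⟨A, i, fun x y h => ?_, fun y => ?_⟩
  · apply IsFractionRing.injective D (FractionRing D)
    rw [← IsLocalization.lift_eq (S := Localization.AtPrime p) hu x,
      ← IsLocalization.lift_eq (S := Localization.AtPrime p) hu y]
    exact congrArg Subtype.val h
  -- The valuation ring dominates the localization at `p`, so the map into it reflects units.
  · rw [← Ideal.mem_primeCompl_iff,
      ← IsLocalization.AtPrime.isUnit_to_map_iff (Localization.AtPrime p) p]
    exact isUnit_map_iff (l.codRestrict A.toSubring hA) _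

/-! ### Covering the blowup, and the zero set. -/

section Cover

variable {K : Type u} [Field K] {n k : ℕ}

/-- The charts attached to minimal choices cover the blowup. -/
theorem exists_minimalChoice_notMem (P : Fin k → Set (Fin n))
    {J : Ideal (MvPolynomial (Fin n) K)}
    (hJ : J = ∏ t, Ideal.span (MvPolynomial.X '' withUnions P t))
    (p : Ideal (reesAlgebra J)) [p.IsPrime]
    {d : ℕ} (hd : d ≠ 0) (r : MvPolynomial (Fin n) K) (hr : r ∈ J ^ d)
    (hrp : reesMonomial d r hr ∉ p) :
    ∃ (Γ : Type u) (_ : LinearOrder Γ) (w : Fin n → Lex (Γᵒᵈ × Fin n))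
      (c : Fin k ⊕ {p : Fin k × Fin k // p.1 < p.2} → Fin n)
      (_ : IsMinimalChoice (withUnions P) w c) (hf : ∏ t, MvPolynomial.X (c t) ∈ J),
      reesGenerator (∏ t, MvPolynomial.X (c t)) hf ∉ p := by
  have hP : ∀ i, (P i).Nonempty := by
    intro i
    by_contra h
    rw [Set.not_nonempty_iff_eq_empty] at h
    have hJ0 : J = ⊥ := by
      rw [hJ, ← Ideal.zero_eq_bot]
      refine Finset.prod_eq_zero (Finset.mem_univ (Sum.inl i)) ?_
      simp [withUnions, h]
    apply hrp
    have hr0 : r = 0 := by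
      rw [hJ0, ← Ideal.zero_eq_bot, zero_pow hd] at hr
      exact hr
    have : reesMonomial d r hr = 0 := Subtype.ext <| by
      change Polynomial.monomial d r = 0
      rw [hr0, map_zero]
    rw [this]
    exact p.zero_mem
  obtain ⟨A, i, hi, hunit⟩ := exists_valuationSubring_isUnit_iff p
  let θ : MvPolynomial (Fin n) K →+* A := i.comp (algebraMap _ (reesAlgebra J))
  have hθ : Function.Injective θ := hi.comp fun x y h =>
    Polynomial.C_injective (congrArg Subtype.val h)
  -- The dual order puts divisors first; the index breaks ties, making `w` injective.
  let w : Fin n → Lex (A.ValueGroupᵒᵈ × Fin n) := fun a =>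
    toLex (OrderDual.toDual (A.valuation (θ (MvPolynomial.X a) : FractionRing (reesAlgebra J))), a)
  have hw : Function.Injective w := fun a b h => congrArg (fun x => (ofLex x).2) h
  obtain ⟨c, hc⟩ := exists_isMinimalChoice P hP w hw
  let f : MvPolynomial (Fin n) K := ∏ t, MvPolynomial.X (c t)
  have hf : f ∈ J := by
    rw [hJ]
    exact Ideal.prod_mem_prod fun t _ => Ideal.subset_span ⟨_, hc.mem t, rfl⟩
  refine ⟨A.ValueGroup, inferInstance, w, c, hc, hf, ?_⟩
  have hle : Ideal.map θ J ≤ Ideal.span {θ f} := by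
    refine (Ideal.map_mono hJ.le).trans (map_prod_span_X_le θ _ c fun t b hb => ?_)
    have h1 : A.valuation (θ (MvPolynomial.X b) : FractionRing (reesAlgebra J)) ≤
        A.valuation (θ (MvPolynomial.X (c t)) : FractionRing (reesAlgebra J)) :=
      Prod.Lex.monotone_fst _ _ (hc.le t b hb)
    obtain ⟨a, ha⟩ := (A.valuation_le_iff _ _).mp h1
    exact ⟨a, Subtype.ext (by rw [mul_comm]; exact ha.symm)⟩
  have hf0 : θ f ≠ 0 := fun h => by
    have := hθ (h.trans (map_zero θ).symm)
    exact Finset.prod_ne_zero_iff.mpr (fun t _ => MvPolynomial.X_ne_zero (c t)) this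
  have h1 : θ r ∈ Ideal.span {θ f ^ d} := by
    rw [← Ideal.span_singleton_pow]
    refine Ideal.pow_right_mono hle d ?_
    rw [← Ideal.map_pow]
    exact Ideal.mem_map_of_mem θ hr
  obtain ⟨q, hq⟩ := Ideal.mem_span_singleton.mp h1
  -- Cancelling `θ f ^ d` exhibits the unit `i (r tᵈ)` as a multiple of `i (f t) ^ d`. As `d ≠ 0`,
  -- `i (f t)` is a unit, so `f t` is outside `p`.
  have h2 : i (reesMonomial d r hr) * θ f ^ d = θ r * i (reesGenerator f hf) ^ d := by
    have := congrArg i (reesMonomial_mul_pow f hf d r hr)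
    rwa [map_mul, map_mul, map_pow, map_pow] at this
  have h3 : i (reesMonomial d r hr) = q * i (reesGenerator f hf) ^ d := by
    refine mul_right_cancel₀ (pow_ne_zero d hf0) ?_
    rw [h2, hq]
    ring
  have h4 := (hunit _).mpr hrp
  rw [h3, IsUnit.mul_iff, isUnit_pow_iff hd] at h4
  exact (hunit _).mp h4.2

theorem isTame_prod_withUnions (P : Fin k → Set (Fin n)) {J : Ideal (MvPolynomial (Fin n) K)}
    (hJ : J = ∏ t, Ideal.span (MvPolynomial.X '' withUnions P t)) : IsTame J := by
  have key : ∀ x : blowup J, ∃ (f : MvPolynomial (Fin n) K) (hf : f ∈ J),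
      x ∈ Proj.basicOpen (reesGrading J) (reesGenerator f hf) ∧
      ((chartMap f hf).comp MvPolynomial.C).Smooth := by
    intro x
    have : x.asHomogeneousIdeal.toIdeal.IsPrime := x.isPrime
    have hx := x.not_irrelevant_le
    -- A point of `Proj` omits some homogeneous element of positive degree, which is what the
    -- covering lemma needs.
    obtain ⟨z, hz, hzx⟩ := Set.not_subset.mp hx
    have hz0 : GradedRing.proj (reesGrading J) 0 z = 0 :=
      (HomogeneousIdeal.mem_irrelevant_iff _ _).mp hz
    have : ∃ d, (DirectSum.decompose (reesGrading J) z d : reesAlgebra J) ∉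
        x.asHomogeneousIdeal.toIdeal := by
      by_contra! h
      exact hzx (x.asHomogeneousIdeal.isHomogeneous.mem_iff.mpr h)
    obtain ⟨d, hd⟩ := this
    have hd0 : d ≠ 0 := by
      rintro rfl
      rw [← GradedRing.proj_apply, hz0] at hd
      exact hd (Ideal.zero_mem _)
    obtain ⟨r, hr, e⟩ := exists_eq_reesMonomial (DirectSum.decompose (reesGrading J) z d).2
    rw [e] at hd
    obtain ⟨Γ, _, w, c, hc, hf, hfx⟩ := exists_minimalChoice_notMem P hJ _ hd0 r hr hd
    obtain ⟨θ, g, hg, hI, hθf, hθg, hφ⟩ := hc.exists_chart (K := K)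
    rw [← hJ] at hI
    exact ⟨_, hf, hfx,
      smooth_chartMap_comp_C hf θ g (fun a => hJ ▸ hg a) hI hθf hθg hφ⟩
  choose f hf hmem hsm using key
  have : IsZariskiLocalAtSource (@Smooth : MorphismProperty Scheme.{u}) :=
    HasRingHomProperty.instIsZariskiLocalAtSource (Q := RingHom.Smooth)
  rw [IsTame]
  refine IsZariskiLocalAtSource.of_iSup_eq_top (P := @Smooth)
    (fun x => Proj.basicOpen (reesGrading J) (reesGenerator (f x) (hf x))) ?_ fun x => ?_
  · exact top_le_iff.mp fun x _ => TopologicalSpace.Opens.mem_iSup.mpr ⟨x, hmem x⟩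
  · have hdeg := reesGenerator_mem (f x) (hf x)
    have h1 : (Proj.basicOpen (reesGrading J) (reesGenerator (f x) (hf x))).ι =
        (Proj.basicOpenIsoSpec (reesGrading J) _ hdeg one_pos).hom ≫
          Proj.awayι (reesGrading J) _ hdeg one_pos := by
      rw [← Proj.basicOpenIsoSpec_inv_ι, Iso.hom_inv_id_assoc]
    have h2 : Proj.awayι (reesGrading J) _ hdeg one_pos ≫ blowupMap J ≫
        Spec.map (CommRingCat.ofHom (algebraMap K (MvPolynomial (Fin n) K))) =
        Spec.map (CommRingCat.ofHom ((chartMap (f x) (hf x)).comp MvPolynomial.C)) := by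
      rw [blowupMap, Category.assoc, Proj.awayι_toSpecZero_assoc, ← Spec.map_comp,
        ← Spec.map_comp, ← CommRingCat.ofHom_comp, ← CommRingCat.ofHom_comp]
      rfl
    rw [h1, Category.assoc, h2]
    have : Smooth (Spec.map
        (CommRingCat.ofHom ((chartMap (f x) (hf x)).comp MvPolynomial.C))) :=
      HasRingHomProperty.Spec_iff.mpr (hsm x)
    infer_instance

theorem prod_mul_pairwiseSumProduct_span (P : Fin k → Set (Fin n)) :
    (∏ i, Ideal.span (MvPolynomial.X '' P i)) *
        pairwiseSumProduct (fun i => Ideal.span (MvPolynomial.X (R := K) '' P i)) =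
      ∏ t, Ideal.span (MvPolynomial.X '' withUnions P t) := by
  rw [Fintype.prod_sum_type, pairwiseSumProduct]
  congr 1
  rw [Finset.prod_subtype (p := fun p : Fin k × Fin k => p.1 < p.2) _ (by simp)]
  refine Finset.prod_congr rfl fun p _ => ?_
  change _ = Ideal.span (MvPolynomial.X '' (P p.1.1 ∪ P p.1.2))
  rw [Set.image_union, Ideal.span_union, Submodule.add_eq_sup]

/-- A prime containing some `I i + I j` contains `I i`, hence the whole product. -/
theorem zeroSet_mul_pairwiseSumProduct (I : Fin k → Ideal (MvPolynomial (Fin n) K)) :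
    zeroSet ((∏ i, I i) * pairwiseSumProduct I) = zeroSet (∏ i, I i) := by
  rw [zeroSet, PrimeSpectrum.zeroLocus_mul]
  refine Set.union_eq_self_of_subset_right fun x hx => ?_
  have h : ∏ p : Fin k × Fin k with p.1 < p.2, (I p.1 + I p.2) ≤ x.asIdeal := hx
  obtain ⟨p, _, hp⟩ := (Ideal.IsPrime.prod_le x.2).mp h
  have h1 : ∏ i, I i ≤ I p.1 :=
    Ideal.le_of_dvd (Finset.dvd_prod_of_mem I (Finset.mem_univ p.1))
  exact h1.trans (le_sup_left.trans hp)

end Cover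

end TameIdeal

end

theorem mainTheorem10 {K : Type*} [Field K] {n k : ℕ}
    (I : Fin k → Ideal (MvPolynomial (Fin n) K))
    (hI : ∀ i, TameIdeal.IsCoordinateIdeal (I i))
    (hnot : ¬ TameIdeal.IsTame (∏ i, I i)) :
    TameIdeal.zeroSet ((∏ i, I i) * TameIdeal.pairwiseSumProduct I) =
        TameIdeal.zeroSet (∏ i, I i) ∧
      TameIdeal.IsTame ((∏ i, I i) * TameIdeal.pairwiseSumProduct I) := by
  choose P hP using hI
  obtain rfl : I = fun i => Ideal.span (MvPolynomial.X '' P i) := funext hP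
  exact ⟨TameIdeal.zeroSet_mul_pairwiseSumProduct _,
    TameIdeal.isTame_prod_withUnions P (TameIdeal.prod_mul_pairwiseSumProduct_span P)⟩
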